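/- \textbf{Birch--Stevens formula for non-primitive characters.} Let $q\ge 1$, let $k>0$ be even, and let $f\in\mathcal S_k(\Gamma_0(q))$ be a newform of weight $k$ and level $q$: a cusp form in the orthogonal complement of the oldforms for the Petersson inner product, which is an eigenfunction of all Hecke operators $T_n$, $n\ge 1$, and has first Fourier coefficient $a_f(1)=1$. Write $$f(z)=\sum_{n\ge 1}a_f(n)e(nz),\qquad a_f(n)=\lambda_f(n)\,n^{(k-1)/2},\qquad e(x)=e^{2\pi i x}.$$ For $r\in\mathbb Q$ and a Dirichlet character $\psi$ let $$L(f,r,s)=\sum_{n\ge 1}\frac{a_f(n)e(nr)}{n^s},\qquad L(f,\psi,s)=\sum_{n\ge 1}\frac{\lambda_f(n)\psi(n)}{n^s},$$ first for $\Re s$ large and then by analytic continuation. For a character $\psi$ modulo $m$ with Gauss sum $\tau(\psi)=\sum_{a \bmod m}\psi(a)e(a/m)$ and for $n\ge 1$ put $$\nu(f,\psi,n)=\tau(\overline\psi)\sum_{\substack{n_1n_2n_3=n\\ (n_1,q)=1}}\psi(n_1)\mu(n_1)\,\overline\psi(n_2)\mu(n_2)\,\lambda_f(n_3)\,n_3^{1/2}.$$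 Let $c\ge 1$. For a Dirichlet character $\chi$ modulo $c$ let $c(\chi)$ be its conductor and $\chi^*$ modulo $c(\chi)$ the primitive character that induces $\chi$. Then the Dirichlet series $L(f,a/c,s)$, for every integer $a$ coprime to $c$, and $L(f,\chi^*,s)$, for every Dirichlet character $\chi$ modulo $c$, converge absolutely in some right half-plane and continue to entire functions of $s$. For every Dirichlet character $\chi$ modulo $c$, $$\nu\bigl(f,\chi^*,c/c(\chi)\bigr)\,L(f,\chi^*,1/2)=\sum_{a\in(\mathbb Z/c\mathbb Z)^\times}\overline\chi(a)\,L(f,a/c,k/2),$$ and conversely, for every integer $a$ coprime to $c$, $$L(f,a/c,k/2)=\frac1{\varphi(c)}\sum_{\chi \bmod c}\chi(a)\,\nu\bigl(f,\chi^*,c/c(\chi)\bigr)\,L(f,\chi^*,1/2).$$ -/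

import Mathlib

open UpperHalfPlane CongruenceSubgroup
open scoped MatrixGroups ModularForm ComplexConjugate

noncomputable section

namespace BirchStevens

/-! ### Newforms of level `Γ₀(q)` -/

/-- The space `S_k(Γ₀(q))` of holomorphic cusp forms of weight `k` for `Γ₀(q)`. -/
abbrev S (q : ℕ) (k : ℤ) : Type := CuspForm (Gamma0 q : Subgroup (GL (Fin 2) ℝ)) k

/-- The `n`-th Fourier coefficient `a_f(n)` at `∞`: `f(z) = ∑ a_f(n) e(nz)`. -/
def fourierCoeff (f : ℍ → ℂ) (n : ℕ) : ℂ := (qExpansion 1 f).coeff n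

/-- The normalized coefficient `λ_f(n)`, given by `a_f(n) = λ_f(n) n^((k-1)/2)`. -/
def heckeEigenvalue (k : ℤ) (f : ℍ → ℂ) (n : ℕ) : ℂ :=
  fourierCoeff f n / (n : ℂ) ^ (((k : ℂ) - 1) / 2)

/-- The Hecke operator `T_n` (all `n ≥ 1`) in weight `k` for `Γ₀(q)` with trivial character:
`(T_n f)(z) = n^(k-1) ∑_{ad = n, (a,q) = 1} d^(-k) ∑_{0 ≤ b < d} f((az+b)/d)`.
For a prime `n ∣ q` this is the operator often written `U_n`. -/
def heckeOperator (q : ℕ) (k : ℤ) (n : ℕ) (f : ℍ → ℂ) (z : ℍ) : ℂ :=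
  (n : ℂ) ^ (k - 1) * ∑ x ∈ n.divisorsAntidiagonal with x.1.Coprime q,
    (x.2 : ℂ) ^ (-k) * ∑ b ∈ Finset.range x.2,
      f (ofComplex (((x.1 : ℂ) * (z : ℂ) + (b : ℂ)) / (x.2 : ℂ)))

/-- The Petersson inner product on `Γ₀(q) \ ℍ` with respect to `dx dy / y²` (which is `volume`
on `ℍ`). A fundamental domain of `Γ₀(q)` is the union of the `γ • 𝒟`, with `𝒟` the standard
fundamental domain of `SL(2, ℤ)` and `γ` in a set of representatives of `Γ₀(q) \ SL(2, ℤ)`. -/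
def peterssonInner (q : ℕ) (k : ℤ) (f g : ℍ → ℂ) : ℂ :=
  ∑ᶠ x : SL(2, ℤ) ⧸ Gamma0 q, ∫ z in ModularGroup.fd, petersson k f g (x.out⁻¹ • z)

/-- The old subspace of `S_k(Γ₀(q))`: the span of the forms `z ↦ g(dz)` with `g ∈ S_k(Γ₀(M))`,
`dM ∣ q`, `M ≠ q`. -/
def oldSubspace (q : ℕ) (k : ℤ) : Submodule ℂ (S q k) :=
  Submodule.span ℂ {h : S q k | ∃ (M d : ℕ) (g : S M k), M * d ∣ q ∧ M ≠ q ∧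
    ∀ z : ℍ, h z = g (ofComplex ((d : ℂ) * (z : ℂ)))}

/-- A newform of weight `k` and level `q`: a cusp form for `Γ₀(q)` that is an eigenfunction of
all Hecke operators, is orthogonal to the old subspace, and has first Fourier coefficient `1`. -/
structure IsNewform {q : ℕ} {k : ℤ} (f : S q k) : Prop where
  normalized : fourierCoeff f 1 = 1
  eigenform : ∀ n : ℕ, 0 < n → ∃ t : ℂ, ∀ z : ℍ, heckeOperator q k n f z = t * f z
  orthogonal_old : ∀ g ∈ oldSubspace q k, peterssonInner q k g f = 0

/-! ### Dirichlet series and their analytic continuation -/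

/-- `F` is the analytic continuation to `ℂ` of the Dirichlet series `∑_{n ≥ 1} a(n) n^(-s)`:
`F` is entire, and on some right half plane the series converges absolutely to `F`. -/
def IsEntireContinuation (a : ℕ → ℂ) (F : ℂ → ℂ) : Prop :=
  Differentiable ℂ F ∧ ∃ σ : ℝ, ∀ s : ℂ, σ < s.re → LSeriesHasSum a s (F s)

theorem IsEntireContinuation.unique {a : ℕ → ℂ} {F G : ℂ → ℂ}
    (hF : IsEntireContinuation a F) (hG : IsEntireContinuation a G) : F = G := by
  obtain ⟨hF, σ, hσ⟩ := hF
  obtain ⟨hG, τ, hτ⟩ := hG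
  refine AnalyticOnNhd.eq_of_eventuallyEq (z₀ := ((max σ τ + 1 : ℝ) : ℂ))
    (fun z _ => hF.analyticAt z) (fun z _ => hG.analyticAt z) ?_
  have hU : IsOpen {s : ℂ | max σ τ < s.re} := isOpen_lt continuous_const Complex.continuous_re
  filter_upwards [hU.mem_nhds (by simp only [Set.mem_ofPred_eq, Complex.ofReal_re]; linarith)]
    with s hs
  exact (hσ s ((le_max_left _ _).trans_lt hs)).unique (hτ s ((le_max_right _ _).trans_lt hs))

open Classical in
/-- The entire function continuing `∑_{n ≥ 1} a(n) n^(-s)`; meaningful if there is one. -/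
def continuedLSeries (a : ℕ → ℂ) : ℂ → ℂ :=
  if h : ∃ F, IsEntireContinuation a F then h.choose else 0

/-- Coefficients `a_f(n) e(nr)` of the additive twist, where `e(x) = exp(2πix)`. -/
def additiveTwistCoeff (f : ℍ → ℂ) (r : ℝ) (n : ℕ) : ℂ :=
  fourierCoeff f n * Complex.exp (2 * Real.pi * Complex.I * (n * r))

/-- The additive twist `L(f, r, s)`, the continuation of `∑ a_f(n) e(nr) n^(-s)`. -/
def additiveTwistL (f : ℍ → ℂ) (r : ℝ) : ℂ → ℂ :=
  continuedLSeries (additiveTwistCoeff f r)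

/-- Coefficients `λ_f(n) χ(n)` of the multiplicative twist. -/
def multiplicativeTwistCoeff (k : ℤ) (f : ℍ → ℂ) {m : ℕ} (χ : DirichletCharacter ℂ m) (n : ℕ) :
    ℂ :=
  heckeEigenvalue k f n * χ n

/-- The naive multiplicative twist `L(f, χ, s)`, the continuation of `∑ λ_f(n) χ(n) n^(-s)`. -/
def multiplicativeTwistL (k : ℤ) (f : ℍ → ℂ) {m : ℕ} (χ : DirichletCharacter ℂ m) : ℂ → ℂ :=
  continuedLSeries (multiplicativeTwistCoeff k f χ)

/-! ### The arithmetic weight -/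

instance neZero_conductor {c : ℕ} [NeZero c] (χ : DirichletCharacter ℂ c) :
    NeZero χ.conductor :=
  ⟨χ.conductor_ne_zero⟩

/-- The arithmetic weight
`ν(f, χ, n) = τ(χ̄) ∑_{n₁n₂n₃ = n, (n₁,q) = 1} χ(n₁) μ(n₁) χ̄(n₂) μ(n₂) λ_f(n₃) n₃^(1/2)`,
with the Gauss sum `τ(χ̄) = ∑_{a mod m} χ̄(a) e(a/m)`, for a character `χ` modulo `m`.
Here `x = (n₁, n₂n₃)` and `y = (n₂, n₃)`. -/
def nu (q : ℕ) (k : ℤ) (f : ℍ → ℂ) {m : ℕ} [NeZero m] (χ : DirichletCharacter ℂ m) (n : ℕ) : ℂ :=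
  gaussSum (star χ) ZMod.stdAddChar *
    ∑ x ∈ n.divisorsAntidiagonal with x.1.Coprime q, ∑ y ∈ x.2.divisorsAntidiagonal,
      χ x.1 * (ArithmeticFunction.moebius x.1 : ℂ) *
        (conj (χ y.1) * (ArithmeticFunction.moebius y.1 : ℂ)) *
        (heckeEigenvalue k f y.2 * (y.2 : ℂ) ^ (1 / 2 : ℂ))

end BirchStevens

end

noncomputable section

namespace BirchStevens

open ConjAct Pointwise Matrix.GeneralLinearGroup

variable {q : ℕ} {k : ℤ}

/-! ### Translates of cusp forms by rationals -/

/-! Write χ* for the primitive character inducing χ and N = c/c(χ). The sum of χ̄(a)e(an/c) over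
units a mod c is the Gauss sum of an imprimitive character: it equals τ(χ̄*) times the sum over n₂d
= N with d ∣ n of μ(n₂)χ̄*(n₂)·d·χ*(n/d) (`sum_units_conj_mul_exp`). After multiplication by λ_f(n),
the Hecke relations in Möbius-inverted form (`apply_mul_eq_sum_moebius`) expand λ_f(n)χ*(n/d) into
coefficients of L(f, χ*, s) dilated by dn₁, where n₁n₃ = d and (n₁, q) = 1. At s = 1/2 the factor
d(dn₁)^(-1/2) is n₃^(1/2), and ν(f, χ*, N) appears.

This coefficient identity passes to the central values because an entire continuation is unique.
Additive twists continue because they are L-functions of the cusp forms f(z + r) on conjugate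
arithmetic groups; twists by primitive characters are linear combinations of these, as primitive
Gauss sums do not vanish. The converse formula is orthogonality of characters. -/

/-- Upper unipotent matrices commute, so the conjugation fixes every translation. -/
lemma strictPeriods_conj_upperRightHom (Γ : Subgroup (GL (Fin 2) ℝ)) (r : ℝ) :
    (toConjAct (upperRightHom r)⁻¹ • Γ).strictPeriods = Γ.strictPeriods := by
  ext x
  have h : toConjAct (upperRightHom r) • upperRightHom x = upperRightHom x := by
    rw [toConjAct_smul, ← AddChar.map_neg_eq_inv, ← AddChar.map_add_eq_mul,
      ← AddChar.map_add_eq_mul, add_neg_cancel_comm]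
  rw [Subgroup.mem_strictPeriods_iff, Subgroup.mem_strictPeriods_iff,
    Subgroup.mem_pointwise_smul_iff_inv_smul_mem, map_inv, inv_inv, h]

lemma strictWidthInfty_eq_one {Γ : Subgroup (GL (Fin 2) ℝ)}
    (h : Γ.strictPeriods = AddSubgroup.zmultiples 1) : Γ.strictWidthInfty = 1 := by
  have : DiscreteTopology Γ.strictPeriods := by
    rw [h]
    infer_instance
  rw [Subgroup.strictPeriods_eq_zmultiples_strictWidthInfty, Eq.comm,
    AddSubgroup.zmultiples_eq_zmultiples_iff
      (not_isOfFinAddOrder_of_isAddTorsionFree one_ne_zero)] at h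
  grind [Subgroup.strictWidthInfty_nonneg]

lemma strictPeriods_Gamma0 (q : ℕ) :
    (Gamma0 q : Subgroup (GL (Fin 2) ℝ)).strictPeriods = AddSubgroup.zmultiples 1 := by
  refine Subgroup.strictPeriods_eq_zmultiples_one_of_T_mem ?_
  rw [Gamma0_mem]
  simp [ModularGroup.T]

lemma one_mem_strictPeriods_Gamma0 (q : ℕ) :
    (1 : ℝ) ∈ (Gamma0 q : Subgroup (GL (Fin 2) ℝ)).strictPeriods := by
  rw [strictPeriods_Gamma0]
  exact AddSubgroup.mem_zmultiples 1

/-- Rationality of `r` matters here: conjugation by a rational matrix preserves commensurability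
with SL(2, ℤ). -/
lemma isArithmetic_conj_upperRightHom (Γ : Subgroup (GL (Fin 2) ℝ)) [Γ.IsArithmetic] (r : ℚ) :
    (toConjAct (upperRightHom (r : ℝ))⁻¹ • Γ).IsArithmetic := by
  convert Subgroup.IsArithmetic.conj Γ (upperRightHom r)⁻¹
  rw [map_inv]
  congr 1
  ext i j
  fin_cases i <;> fin_cases j <;> simp

lemma hasSum_fourierCoeff [NeZero q] (f : S q k) (z : ℍ) :
    HasSum (fun n ↦ fourierCoeff f n * Complex.exp (2 * Real.pi * Complex.I * (n * z))) (f z) := by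
  convert ModularForm.hasSum_qExpansion f one_pos (one_mem_strictPeriods_Gamma0 q) z
    using 2 with n
  rw [fourierCoeff, Function.Periodic.qParam, ← Complex.exp_nat_mul]
  congr 2
  push_cast
  ring

lemma slash_upperRightHom (f : ℍ → ℂ) (r : ℝ) (z : ℍ) :
    (f ∣[k] (upperRightHom r : GL (Fin 2) ℝ)) z = f (r +ᵥ z) := by
  have h : (upperRightHom r : GL (Fin 2) ℝ) • z = r +ᵥ z := by
    ext
    rw [coe_smul_of_det_pos (by simp)]
    simp [num, denom, add_comm]
  simp only [ModularForm.slash_def, h]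
  simp [denom, σ]

/-- The additive twist of the `L`-series of a cusp form by a rational number is the `L`-series of
the translated form, hence entire. -/
lemma exists_isEntireContinuation_additiveTwist [NeZero q] (hk : 0 < k) (f : S q k) (r : ℚ) :
    ∃ F, IsEntireContinuation (additiveTwistCoeff f r) F := by
  let Γ' := toConjAct (upperRightHom (r : ℝ))⁻¹ • (Gamma0 q : Subgroup (GL (Fin 2) ℝ))
  have : Γ'.IsArithmetic := isArithmetic_conj_upperRightHom _ r
  let g : CuspForm Γ' k := CuspForm.translate f (upperRightHom (r : ℝ))
  have hw : Γ'.strictWidthInfty = 1 :=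
    strictWidthInfty_eq_one
      ((strictPeriods_conj_upperRightHom _ _).trans (strictPeriods_Gamma0 q))
  have h1 : (1 : ℝ) ∈ Γ'.strictPeriods := by
    simp only [Γ', strictPeriods_conj_upperRightHom]
    exact one_mem_strictPeriods_Gamma0 q
  have hcoeff (n : ℕ) : additiveTwistCoeff f r n = (qExpansion 1 g).coeff n := by
    refine ModularFormClass.qExpansion_coeff_unique (f := g) one_pos h1 (fun z ↦ ?_) n
    have hg : g z = f ((r : ℝ) +ᵥ z) := slash_upperRightHom f r z
    rw [hg]
    convert hasSum_fourierCoeff f ((r : ℝ) +ᵥ z) using 2 with n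
    rw [additiveTwistCoeff, smul_eq_mul, mul_assoc, Function.Periodic.qParam,
      ← Complex.exp_nat_mul, ← Complex.exp_add]
    congr 2
    push_cast [coe_vadd]
    ring
  refine ⟨ModularForm.L hk g, CuspForm.differentiable_L hk g, k / 2 + 1, fun s hs ↦ ?_⟩
  -- For `s ≠ 0` the value `0 ^ s` is zero, so the convention for the term at `n = 0` agrees with
  -- plain division.
  have hs0 : s ≠ 0 := by
    rintro rfl
    have : (0 : ℝ) < k := mod_cast hk
    simp only [Complex.zero_re] at hs
    linarith
  have := CuspForm.hasSum_L hk g hs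
  rw [hw] at this
  simpa [LSeriesHasSum, funext (LSeries.term_of_ne_zero' hs0 _), funext hcoeff] using this

lemma isEntireContinuation_continuedLSeries {a : ℕ → ℂ} (h : ∃ F, IsEntireContinuation a F) :
    IsEntireContinuation a (continuedLSeries a) := by
  rw [continuedLSeries, dif_pos h]
  exact h.choose_spec

lemma isEntireContinuation_additiveTwistL [NeZero q] (hk : 0 < k) (f : S q k) (r : ℚ) :
    IsEntireContinuation (additiveTwistCoeff f r) (additiveTwistL f r) :=
  isEntireContinuation_continuedLSeries (exists_isEntireContinuation_additiveTwist hk f r)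

/-! ### Hecke relations -/

/-- A geometric sum whose ratio is a `d`-th root of unity, trivial exactly when `d ∣ n`. It serves
both the Hecke operators and the exponential sums modulo `m * d`. -/
lemma sum_range_exp (d n : ℕ) (hd : d ≠ 0) :
    ∑ b ∈ Finset.range d, Complex.exp (2 * Real.pi * Complex.I * (n * b / d)) =
      if d ∣ n then (d : ℂ) else 0 := by
  have hd' : (d : ℂ) ≠ 0 := mod_cast hd
  set ζ := Complex.exp (2 * Real.pi * Complex.I * (n / d)) with hζ
  have hpow (b : ℕ) : Complex.exp (2 * Real.pi * Complex.I * (n * b / d)) = ζ ^ b := by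
    rw [hζ, ← Complex.exp_nat_mul]
    congr 1
    ring
  have hζd : ζ ^ d = 1 := by
    rw [hζ, ← Complex.exp_nat_mul, Complex.exp_eq_one_iff]
    exact ⟨n, by push_cast; field_simp⟩
  simp only [hpow]
  split_ifs with h
  · obtain ⟨l, rfl⟩ := h
    have : ζ = 1 := by
      rw [hζ, Complex.exp_eq_one_iff]
      exact ⟨l, by push_cast; field_simp⟩
    simp [this]
  · have hne : ζ ≠ 1 := by
      intro h1
      rw [hζ, Complex.exp_eq_one_iff] at h1
      obtain ⟨l, hl⟩ := h1
      refine h (Int.natCast_dvd_natCast.mp ⟨l, ?_⟩)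
      have h2 : (n : ℂ) / d = l := by
        have := Complex.two_pi_I_ne_zero
        rw [mul_comm] at hl
        exact mul_right_cancel₀ this hl
      rw [div_eq_iff hd'] at h2
      have h3 : (n : ℂ) = ((d * l : ℤ) : ℂ) := by rw [h2]; push_cast; ring
      exact_mod_cast h3
    rw [geom_sum_eq hne, hζd, sub_self, zero_div]

lemma hasSum_ite_dvd_iff {u : ℕ → ℂ} {d : ℕ} (hd : d ≠ 0) {A : ℂ} :
    HasSum (fun n ↦ if d ∣ n then u n else 0) A ↔ HasSum (fun l ↦ u (d * l)) A := by
  rw [← (mul_right_injective₀ hd).hasSum_iff]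
  · simp [Function.comp_def]
  · intro n hn
    rw [if_neg]
    rintro ⟨l, rfl⟩
    exact hn ⟨l, rfl⟩

/-- The contribution of `∑_b f((az+b)/d)` to the Fourier expansion of a Hecke operator. -/
lemma hasSum_sum_translates [NeZero q] (f : S q k) {a d : ℕ} (ha : a ≠ 0) (hd : d ≠ 0) (z : ℍ) :
    HasSum (fun m ↦ if a ∣ m then d * fourierCoeff f (d * (m / a)) *
        Complex.exp (2 * Real.pi * Complex.I * (m * z)) else 0)
      (∑ b ∈ Finset.range d, f (ofComplex (((a : ℂ) * (z : ℂ) + (b : ℂ)) / (d : ℂ)))) := by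
  have hd' : (d : ℂ) ≠ 0 := mod_cast hd
  have him (b : ℕ) : 0 < (((a : ℂ) * (z : ℂ) + (b : ℂ)) / (d : ℂ)).im := by
    rw [show (d : ℂ) = ((d : ℝ) : ℂ) by simp, Complex.div_ofReal_im]
    have : 0 < (a : ℝ) * z.im := mul_pos (by positivity) z.im_pos
    simp only [Complex.add_im, Complex.natCast_im, add_zero, Complex.mul_im, Complex.natCast_re,
      zero_mul, coe_im]
    positivity
  have h1 : HasSum (fun n ↦ if d ∣ n then d * fourierCoeff f n *
        Complex.exp (2 * Real.pi * Complex.I * (n * (a * z / d))) else 0)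
      (∑ b ∈ Finset.range d, f (ofComplex (((a : ℂ) * (z : ℂ) + (b : ℂ)) / (d : ℂ)))) := by
    have := hasSum_sum (s := Finset.range d) (fun b _ ↦
      hasSum_fourierCoeff f (ofComplex (((a : ℂ) * (z : ℂ) + (b : ℂ)) / (d : ℂ))))
    convert this using 2 with n
    have h2 (b : ℕ) : fourierCoeff f n * Complex.exp (2 * Real.pi * Complex.I *
        (n * (ofComplex (((a : ℂ) * (z : ℂ) + (b : ℂ)) / (d : ℂ)) : ℍ))) =
        fourierCoeff f n * Complex.exp (2 * Real.pi * Complex.I * (n * (a * z / d))) *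
          Complex.exp (2 * Real.pi * Complex.I * (n * b / d)) := by
      rw [ofComplex_apply_of_im_pos (him b), mul_assoc (fourierCoeff f n), ← Complex.exp_add]
      congr 2
      simp only
      ring
    simp only [h2]
    rw [← Finset.mul_sum, sum_range_exp d n hd]
    split_ifs <;> ring
  -- Both series are indexed by `l`, through `n = d * l` and `m = a * l`; then `n * (a * z / d) = m
  -- * z`.
  refine (hasSum_ite_dvd_iff ha).mpr ?_
  convert (hasSum_ite_dvd_iff hd).mp h1 using 3 with l
  · rw [Nat.mul_div_cancel_left _ (Nat.pos_of_ne_zero ha)]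
  · congr 1
    push_cast
    field_simp

/-- The Fourier coefficients of `T_n f`. -/
lemma hasSum_heckeOperator [NeZero q] (f : S q k) (n : ℕ) (z : ℍ) :
    HasSum (fun m ↦ (∑ x ∈ n.divisorsAntidiagonal with x.1.Coprime q,
        if x.1 ∣ m then (x.1 : ℂ) ^ (k - 1) * fourierCoeff f (x.2 * (m / x.1)) else 0) *
          Complex.exp (2 * Real.pi * Complex.I * (m * z)))
      (heckeOperator q k n f z) := by
  rw [heckeOperator, Finset.mul_sum]
  simp only [Finset.sum_mul]
  refine hasSum_sum fun x hx ↦ ?_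
  rw [Finset.mem_filter, Nat.mem_divisorsAntidiagonal] at hx
  obtain ⟨⟨hx, hn⟩, -⟩ := hx
  have h1 : x.1 ≠ 0 := by rintro h; simp [h] at hx; omega
  have h2 : x.2 ≠ 0 := by rintro h; simp [h] at hx; omega
  refine (((hasSum_sum_translates f h1 h2 z).mul_left ((x.2 : ℂ) ^ (-k))).mul_left
    ((n : ℂ) ^ (k - 1))).congr_fun fun m ↦ ?_
  split_ifs
  · have h2' : (x.2 : ℂ) ≠ 0 := mod_cast h2
    -- With n = ad, the factors combine as n^(k-1) · d^(-k) · d = a^(k-1).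
    rw [← hx, Nat.cast_mul, mul_zpow, zpow_neg, zpow_sub_one₀ h2']
    field_simp
  · simp

/-- Compare Fourier coefficients in T_n f = t f. At `m = 1` only the divisor pair `(1, n)` survives,
so the normalization a_f(1) = 1 gives t = a_f(n). -/
lemma IsNewform.fourierCoeff_mul [NeZero q] {f : S q k} (hf : IsNewform f) {n : ℕ} (hn : 0 < n)
    (m : ℕ) : fourierCoeff f n * fourierCoeff f m =
      ∑ x ∈ n.divisorsAntidiagonal with x.1.Coprime q,
        if x.1 ∣ m then (x.1 : ℂ) ^ (k - 1) * fourierCoeff f (x.2 * (m / x.1)) else 0 := by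
  obtain ⟨t, ht⟩ := hf.eigenform n hn
  have hq (z : ℍ) (m : ℕ) : Function.Periodic.qParam 1 z ^ m =
      Complex.exp (2 * Real.pi * Complex.I * (m * z)) := by
    rw [Function.Periodic.qParam, ← Complex.exp_nat_mul]
    congr 1
    push_cast
    ring
  have key (m : ℕ) : t * fourierCoeff f m = ∑ x ∈ n.divisorsAntidiagonal with x.1.Coprime q,
        if x.1 ∣ m then (x.1 : ℂ) ^ (k - 1) * fourierCoeff f (x.2 * (m / x.1)) else 0 := by
    refine (ModularFormClass.qExpansion_coeff_unique (f := t • f) (c := fun m ↦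
      t * fourierCoeff f m) one_pos (one_mem_strictPeriods_Gamma0 q) (fun z ↦ ?_) m).trans
      (ModularFormClass.qExpansion_coeff_unique (f := t • f) (c := fun m ↦
        ∑ x ∈ n.divisorsAntidiagonal with x.1.Coprime q,
        if x.1 ∣ m then (x.1 : ℂ) ^ (k - 1) * fourierCoeff f (x.2 * (m / x.1)) else 0)
        one_pos (one_mem_strictPeriods_Gamma0 q) (fun z ↦ ?_) m).symm
    · simpa [hq, mul_assoc] using (hasSum_fourierCoeff f z).mul_left t
    · have := hasSum_heckeOperator f n z
      rw [ht z] at this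
      simpa [hq] using this
  have h1 : t = fourierCoeff f n := by
    have := key 1
    rw [hf.normalized, mul_one] at this
    rw [this, Finset.sum_eq_single (1, n)]
    · simp
    · rintro ⟨a, b⟩ hx hne
      rw [Finset.mem_filter, Nat.mem_divisorsAntidiagonal] at hx
      rw [if_neg]
      rw [Nat.dvd_one]
      rintro rfl
      exact hne (by simpa using hx.1.1)
    · intro h
      simp at h
      omega
  rw [← h1, key]

lemma natCast_sq_cpow_half (d : ℕ) (hd : d ≠ 0) (j : ℤ) :
    ((d * d : ℕ) : ℂ) ^ ((j : ℂ) / 2) = (d : ℂ) ^ j := by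
  have hd' : (d : ℂ) ≠ 0 := mod_cast hd
  rw [Nat.cast_mul, Complex.natCast_mul_natCast_cpow, ← Complex.cpow_add _ _ hd', add_halves,
    Complex.cpow_intCast]

/-- For n = da and m = db one has nm = d² · ab, and (d²)^((k-1)/2) cancels the weight d^(k-1). -/
lemma IsNewform.heckeEigenvalue_mul [NeZero q] {f : S q k} (hf : IsNewform f) {n m : ℕ}
    (hn : n ≠ 0) (hm : m ≠ 0) : heckeEigenvalue k f n * heckeEigenvalue k f m =
      ∑ d ∈ (n.gcd m).divisors with d.Coprime q, heckeEigenvalue k f (n / d * (m / d)) := by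
  have hset : (n.gcd m).divisors.filter (·.Coprime q) =
      {d ∈ n.divisors | d.Coprime q ∧ d ∣ m} := by
    ext d
    simp only [Finset.mem_filter, Nat.mem_divisors, Nat.dvd_gcd_iff, ne_eq, Nat.gcd_eq_zero_iff]
    tauto
  rw [heckeEigenvalue, heckeEigenvalue, div_mul_div_comm, hf.fourierCoeff_mul (by omega),
    Finset.sum_filter, Nat.sum_divisorsAntidiagonal (f := fun a b ↦ if a.Coprime q then
      if a ∣ m then (a : ℂ) ^ (k - 1) * fourierCoeff f (b * (m / a)) else 0 else 0), hset,
    Finset.sum_filter, Finset.sum_div]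
  refine Finset.sum_congr rfl fun d hd ↦ ?_
  by_cases h1 : d.Coprime q
  swap
  · rw [if_neg h1, if_neg (fun h ↦ h1 h.1), zero_div]
  by_cases h2 : d ∣ m
  swap
  · rw [if_pos h1, if_neg h2, if_neg (fun h ↦ h2 h.2), zero_div]
  rw [if_pos h1, if_pos h2, if_pos ⟨h1, h2⟩]
  obtain ⟨a, rfl⟩ := Nat.dvd_of_mem_divisors hd
  obtain ⟨b, rfl⟩ := h2
  have hd0 : d ≠ 0 := left_ne_zero_of_mul hn
  rw [Nat.mul_div_cancel_left _ (by omega), Nat.mul_div_cancel_left _ (by omega), heckeEigenvalue,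
    ← Complex.natCast_mul_natCast_cpow, ← Nat.cast_mul,
    show d * a * (d * b) = (d * d) * (a * b) by ring, Nat.cast_mul (d * d),
    Complex.natCast_mul_natCast_cpow]
  have h := natCast_sq_cpow_half d hd0 (k - 1)
  push_cast at h ⊢
  rw [h, mul_div_mul_left]
  exact zpow_ne_zero _ (mod_cast hd0)

lemma sum_divisors_moebius (n : ℕ) :
    ∑ d ∈ n.divisors, (ArithmeticFunction.moebius d : ℂ) = if n = 1 then 1 else 0 := by
  have h := congrArg (fun F : ArithmeticFunction ℂ ↦ F n)
    (ArithmeticFunction.coe_moebius_mul_coe_zeta (R := ℂ))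
  simp only [ArithmeticFunction.coe_mul_zeta_apply, ArithmeticFunction.one_apply,
    ArithmeticFunction.intCoe_apply] at h
  exact h

lemma sum_divisors_sum_divisors_div {M : Type*} [AddCommMonoid M] (G : ℕ) (F : ℕ → ℕ → M) :
    ∑ e ∈ G.divisors, ∑ d ∈ (G / e).divisors, F e d =
      ∑ g ∈ G.divisors, ∑ e ∈ g.divisors, F e (g / e) := by
  rw [Finset.sum_sigma', Finset.sum_sigma']
  refine Finset.sum_nbij' (fun x ↦ ⟨x.1 * x.2, x.1⟩) (fun x ↦ ⟨x.2, x.1 / x.2⟩) ?_ ?_ ?_ ?_ ?_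
  · rintro ⟨e, d⟩ h
    simp only [Finset.mem_sigma, Nat.mem_divisors] at h ⊢
    obtain ⟨⟨⟨r, rfl⟩, hG⟩, h2, h3⟩ := h
    have he : 0 < e := Nat.pos_of_ne_zero (left_ne_zero_of_mul hG)
    rw [Nat.mul_div_cancel_left _ he] at h2 h3
    exact ⟨⟨Nat.mul_dvd_mul_left _ h2, hG⟩, dvd_mul_right _ _,
      mul_ne_zero he.ne' (ne_zero_of_dvd_ne_zero h3 h2)⟩
  · rintro ⟨g, e⟩ h
    simp only [Finset.mem_sigma, Nat.mem_divisors] at h ⊢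
    obtain ⟨⟨h1, hG⟩, h2, h3⟩ := h
    exact ⟨⟨h2.trans h1, hG⟩, Nat.div_dvd_div h2 h1,
      (Nat.div_pos (Nat.le_of_dvd (by omega) (h2.trans h1))
        (Nat.pos_of_dvd_of_pos h2 (by omega))).ne'⟩
  · rintro ⟨e, d⟩ h
    simp only [Finset.mem_sigma, Nat.mem_divisors] at h
    have he : 0 < e := Nat.pos_of_ne_zero (ne_zero_of_dvd_ne_zero h.1.2 h.1.1)
    simp [Nat.mul_div_cancel_left _ he]
  · rintro ⟨g, e⟩ h
    simp only [Finset.mem_sigma, Nat.mem_divisors] at h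
    simp [Nat.mul_div_cancel' h.2.1]
  · rintro ⟨e, d⟩ h
    simp only [Finset.mem_sigma, Nat.mem_divisors] at h
    have he : 0 < e := Nat.pos_of_ne_zero (ne_zero_of_dvd_ne_zero h.1.2 h.1.1)
    simp [Nat.mul_div_cancel_left _ he]

/-- Möbius inversion of the Hecke relations. -/
lemma apply_mul_eq_sum_moebius {l : ℕ → ℂ} {q : ℕ} (hl : ∀ n m : ℕ, n ≠ 0 → m ≠ 0 →
      l n * l m = ∑ d ∈ (n.gcd m).divisors with d.Coprime q, l (n / d * (m / d)))
    {n m : ℕ} (hn : n ≠ 0) (hm : m ≠ 0) :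
    l (n * m) = ∑ e ∈ (n.gcd m).divisors with e.Coprime q,
      (ArithmeticFunction.moebius e : ℂ) * (l (n / e) * l (m / e)) := by
  have hG : n.gcd m ≠ 0 := fun h ↦ hn (Nat.gcd_eq_zero_iff.mp h).1
  -- Apart from the Möbius factor, `F e d` depends only on g = ed. Grouping by g leaves the sum of
  -- μ(e) over e ∣ g, which vanishes unless g = 1.
  let F (e d : ℕ) : ℂ := if (e * d).Coprime q then
    (ArithmeticFunction.moebius e : ℂ) * l (n / (e * d) * (m / (e * d))) else 0
  have h1 : ∀ e ∈ (n.gcd m).divisors, (if e.Coprime q then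
      (ArithmeticFunction.moebius e : ℂ) * (l (n / e) * l (m / e)) else 0) =
        ∑ d ∈ (n.gcd m / e).divisors, F e d := by
    intro e he
    have hdvd := Nat.dvd_of_mem_divisors he
    have hen := hdvd.trans (Nat.gcd_dvd_left n m)
    have hem := hdvd.trans (Nat.gcd_dvd_right n m)
    have hne : n / e ≠ 0 := (Nat.div_ne_zero_iff_of_dvd hen).mpr
      ⟨hn, ne_zero_of_dvd_ne_zero hn hen⟩
    have hme : m / e ≠ 0 := (Nat.div_ne_zero_iff_of_dvd hem).mpr
      ⟨hm, ne_zero_of_dvd_ne_zero hm hem⟩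
    split_ifs with h
    · rw [hl _ _ hne hme, Nat.gcd_div hen hem, Finset.sum_filter, Finset.mul_sum]
      refine Finset.sum_congr rfl fun d _ ↦ ?_
      simp only [F, Nat.coprime_mul_iff_left, and_iff_right h, mul_ite, mul_zero,
        Nat.div_div_eq_div_mul]
    · simp [F, Nat.coprime_mul_iff_left, h]
  rw [Finset.sum_filter, Finset.sum_congr rfl h1, sum_divisors_sum_divisors_div,
    Finset.sum_eq_single 1]
  · simp [F]
  · intro g _ hg1
    have : ∑ e ∈ g.divisors, F e (g / e) = ∑ e ∈ g.divisors,
        (ArithmeticFunction.moebius e : ℂ) *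
          (if g.Coprime q then l (n / g * (m / g)) else 0) := by
      refine Finset.sum_congr rfl fun e he ↦ ?_
      simp only [F, Nat.mul_div_cancel' (Nat.dvd_of_mem_divisors he), mul_ite, mul_zero]
    rw [this, ← Finset.sum_mul, sum_divisors_moebius, if_neg hg1, zero_mul]
  · intro h
    exact absurd (Nat.one_mem_divisors.mpr hG) h

/-! ### Gauss sums of imprimitive characters -/

/-- The exponential sum `∑_{b mod M} ψ(b) e(bn/M)`. -/
def expSum {m : ℕ} (ψ : DirichletCharacter ℂ m) (M n : ℕ) : ℂ :=
  ∑ b ∈ Finset.range M, ψ b * Complex.exp (2 * Real.pi * Complex.I * (n * b / M))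

lemma sum_zmod_eq_sum_range {M : Type*} [AddCommMonoid M] (c : ℕ) [NeZero c] (F : ZMod c → M) :
    ∑ x : ZMod c, F x = ∑ a ∈ Finset.range c, F a := by
  refine Finset.sum_nbij' (fun x ↦ x.val) (fun a ↦ (a : ZMod c)) ?_ ?_ ?_ ?_ ?_
  · intro x _
    simpa using ZMod.val_lt x
  · simp
  · simp
  · intro a ha
    exact ZMod.val_natCast_of_lt (Finset.mem_range.mp ha)
  · simp

/-- Primitivity makes this valid for all `n`, including those not coprime to `m`, where both sides
vanish. -/
lemma expSum_self {m : ℕ} [NeZero m] (ψ : DirichletCharacter ℂ m) (hψ : ψ.IsPrimitive) (n : ℕ) :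
    expSum ψ m n = ψ⁻¹ n * gaussSum ψ ZMod.stdAddChar := by
  rw [← gaussSum_mulShift_of_isPrimitive _ hψ, gaussSum, sum_zmod_eq_sum_range, expSum]
  refine Finset.sum_congr rfl fun b _ ↦ ?_
  rw [AddChar.mulShift_apply, show (n : ZMod m) * b = ((n * b : ℤ) : ZMod m) by push_cast; rfl,
    ZMod.stdAddChar_coe]
  congr 2
  push_cast
  ring

lemma sum_range_mul_eq {M : Type*} [AddCommMonoid M] (m d : ℕ) (F : ℕ → M) :
    ∑ x ∈ Finset.range (m * d), F x =
      ∑ j ∈ Finset.range d, ∑ b ∈ Finset.range m, F (b + m * j) := by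
  induction d with
  | zero => simp
  | succ d ih =>
    rw [Nat.mul_succ, Finset.sum_range_add, ih, Finset.sum_range_succ]
    simp only [add_comm]

/-- Write residues modulo `m * d` as `b + m * j`. Since `ψ` sees only `b`, the sum over `j` is
geometric and detects `d ∣ n`. -/
lemma expSum_mul {m : ℕ} [NeZero m] (ψ : DirichletCharacter ℂ m) {d : ℕ} (hd : d ≠ 0) (n : ℕ) :
    expSum ψ (m * d) n = if d ∣ n then d * expSum ψ m (n / d) else 0 := by
  have hd' : (d : ℂ) ≠ 0 := mod_cast hd
  have hm' : (m : ℂ) ≠ 0 := mod_cast NeZero.ne m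
  have h : expSum ψ (m * d) n = (∑ j ∈ Finset.range d,
      Complex.exp (2 * Real.pi * Complex.I * (n * j / d))) *
      ∑ b ∈ Finset.range m, ψ b *
        Complex.exp (2 * Real.pi * Complex.I * (n * b / (m * d))) := by
    rw [expSum, sum_range_mul_eq, Finset.sum_mul_sum]
    refine Finset.sum_congr rfl fun j _ ↦ Finset.sum_congr rfl fun b _ ↦ ?_
    rw [mul_left_comm, ← Complex.exp_add]
    congr 2
    · simp
    · push_cast
      field_simp
      ring
  rw [h, sum_range_exp d n hd]
  split_ifs with hdn
  · obtain ⟨r, rfl⟩ := hdn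
    rw [Nat.mul_div_cancel_left _ (by omega), expSum]
    congr 1
    refine Finset.sum_congr rfl fun b _ ↦ ?_
    congr 2
    push_cast
    field_simp
  · rw [zero_mul]

lemma sum_range_filter_dvd {M : Type*} [AddCommMonoid M] {e : ℕ} (he : e ≠ 0) (r : ℕ)
    (F : ℕ → M) :
    ∑ a ∈ Finset.range (e * r) with e ∣ a, F a = ∑ b ∈ Finset.range r, F (e * b) := by
  symm
  refine Finset.sum_nbij (fun b ↦ e * b) ?_ ?_ ?_ ?_
  · intro b hb
    simp only [Finset.mem_range, Finset.mem_filter, dvd_mul_right, and_true] at hb ⊢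
    exact Nat.mul_lt_mul_of_pos_left hb (by omega)
  · intro a _ b _ h
    exact mul_right_injective₀ he h
  · rintro a ha
    simp only [Finset.coe_filter, Finset.mem_range, Set.mem_ofPred_eq] at ha
    obtain ⟨h, b, rfl⟩ := ha
    exact ⟨b, by simpa using Nat.lt_of_mul_lt_mul_left h, rfl⟩
  · simp

/-- Coprimality to `N` is detected by summing μ(e) over e ∣ (a, N); the multiples a = eb then have b
running modulo mN/e. -/
lemma sum_coprime_eq_sum_moebius_mul_expSum {m : ℕ} (ψ : DirichletCharacter ℂ m)
    {N : ℕ} (hN : N ≠ 0) (n : ℕ) :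
    ∑ a ∈ Finset.range (m * N) with a.Coprime N,
        ψ a * Complex.exp (2 * Real.pi * Complex.I * (n * a / (m * N : ℕ))) =
      ∑ x ∈ N.divisorsAntidiagonal,
        (ArithmeticFunction.moebius x.1 : ℂ) * ψ x.1 * expSum ψ (m * x.2) n := by
  set F : ℕ → ℂ := fun a ↦ ψ a * Complex.exp (2 * Real.pi * Complex.I * (n * a / (m * N : ℕ)))
  have h1 (a : ℕ) : (if a.Coprime N then F a else 0) =
      ∑ e ∈ N.divisors, if e ∣ a then (ArithmeticFunction.moebius e : ℂ) * F a else 0 := by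
    have h2 : N.divisors.filter (· ∣ a) = (a.gcd N).divisors := by
      ext e
      simp only [Finset.mem_filter, Nat.mem_divisors, Nat.dvd_gcd_iff, ne_eq, Nat.gcd_eq_zero_iff]
      tauto
    rw [← Finset.sum_filter, h2, ← Finset.sum_mul, sum_divisors_moebius, ite_mul, one_mul, zero_mul]
  rw [Finset.sum_filter, Finset.sum_congr rfl fun a _ ↦ h1 a, Finset.sum_comm,
    Nat.sum_divisorsAntidiagonal (f := fun e d ↦
      (ArithmeticFunction.moebius e : ℂ) * ψ e * expSum ψ (m * d) n)]
  refine Finset.sum_congr rfl fun e he ↦ ?_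
  obtain ⟨d, rfl⟩ := Nat.dvd_of_mem_divisors he
  have he0 : e ≠ 0 := left_ne_zero_of_mul hN
  have he' : (e : ℂ) ≠ 0 := mod_cast he0
  rw [Nat.mul_div_cancel_left _ (by omega), ← Finset.sum_filter, ← Finset.mul_sum, mul_assoc,
    show m * (e * d) = e * (m * d) by ring, sum_range_filter_dvd he0, expSum,
    Finset.mul_sum (a := ψ e)]
  congr 1
  refine Finset.sum_congr rfl fun b _ ↦ ?_
  simp only [F]
  rw [Nat.cast_mul, map_mul, mul_assoc]
  congr 3
  push_cast
  rw [show (m : ℂ) * (e * d) = e * (m * d) by ring,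
    show (n : ℂ) * (e * b) = e * (n * b) by ring, mul_div_mul_left _ _ he']

lemma sum_units_eq_sum_range (c : ℕ) [NeZero c] (F : ZMod c → ℂ) :
    ∑ u : (ZMod c)ˣ, F u = ∑ a ∈ Finset.range c with a.Coprime c, F a := by
  refine Finset.sum_bij (fun u _ ↦ (u : ZMod c).val) ?_ ?_ ?_ ?_
  · intro u _
    simpa using ⟨ZMod.val_lt _, ZMod.val_coe_unit_coprime u⟩
  · intro u _ v _ h
    exact Units.ext (ZMod.val_injective c h)
  · intro a ha
    rw [Finset.mem_filter, Finset.mem_range] at ha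
    exact ⟨ZMod.unitOfCoprime a ha.2, Finset.mem_univ _, by
      simpa using ZMod.val_natCast_of_lt ha.1⟩
  · simp

lemma sum_units_conj_mul_exp {c : ℕ} [NeZero c] (χ : DirichletCharacter ℂ c) (n : ℕ) :
    ∑ u : (ZMod c)ˣ, conj (χ (u : ZMod c)) *
        Complex.exp (2 * Real.pi * Complex.I * (n * (u : ZMod c).val / c)) =
      gaussSum (star χ.primitiveCharacter) ZMod.stdAddChar *
        ∑ x ∈ (c / χ.conductor).divisorsAntidiagonal, (ArithmeticFunction.moebius x.1 : ℂ) *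
          conj (χ.primitiveCharacter x.1) *
            if x.2 ∣ n then x.2 * χ.primitiveCharacter ((n / x.2 : ℕ) : ZMod χ.conductor)
            else 0 := by
  set m := χ.conductor with hm
  set χ' := χ.primitiveCharacter with hχ'
  set N := c / m with hN
  have hc : m * N = c := Nat.mul_div_cancel' χ.conductor_dvd_level
  have hN0 : N ≠ 0 := right_ne_zero_of_mul (hc ▸ NeZero.ne c)
  have hprim : (star χ').IsPrimitive := by
    rw [MulChar.star_eq_inv, DirichletCharacter.isPrimitive_def, DirichletCharacter.conductor_inv]
    exact χ.primitiveCharacter_isPrimitive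
  rw [sum_units_eq_sum_range c (fun x ↦ conj (χ x) *
    Complex.exp (2 * Real.pi * Complex.I * (n * x.val / c)))]
  -- Since the primitive character already vanishes off the units modulo `m`, only coprimality to
  -- `N` has to be imposed.
  have h1 : ∑ a ∈ Finset.range c with a.Coprime c, conj (χ a) *
        Complex.exp (2 * Real.pi * Complex.I * (n * (a : ZMod c).val / c)) =
      ∑ a ∈ Finset.range (m * N) with a.Coprime N, (star χ') a *
        Complex.exp (2 * Real.pi * Complex.I * (n * a / (m * N : ℕ))) := by
    rw [hc, Finset.sum_filter, Finset.sum_filter]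
    refine Finset.sum_congr rfl fun a ha ↦ ?_
    rw [Finset.mem_range] at ha
    rw [ZMod.val_natCast_of_lt ha, MulChar.star_apply]
    by_cases haN : a.Coprime N
    · rw [if_pos haN]
      by_cases ham : a.Coprime m
      · have hac : a.Coprime c := by
          rw [← hc]
          exact Nat.Coprime.mul_right ham haN
        have := χ.primitiveCharacter_apply_of_isCoprime (Nat.isCoprime_iff_coprime.mpr hac)
        simp only [Int.cast_natCast] at this
        rw [if_pos hac, hχ', this]
        rfl
      · rw [if_neg (fun h ↦ ham (h.coprime_dvd_right χ.conductor_dvd_level)),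
          MulChar.map_nonunit _ (by rwa [ZMod.isUnit_iff_coprime]), star_zero, zero_mul]
    · rw [if_neg haN, if_neg (fun h ↦ haN (h.coprime_dvd_right ⟨m, by rw [mul_comm, hc]⟩))]
  rw [h1, sum_coprime_eq_sum_moebius_mul_expSum _ hN0, Finset.mul_sum]
  refine Finset.sum_congr rfl fun x hx ↦ ?_
  have hx2 : x.2 ≠ 0 := (Nat.ne_zero_of_mem_divisorsAntidiagonal hx).2
  rw [expSum_mul _ hx2, MulChar.star_apply]
  split_ifs
  · rw [expSum_self _ hprim, MulChar.star_eq_inv, inv_inv]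
    simp only [RCLike.star_def]
    ring
  · simp

/-- Otherwise the discrete Fourier transform of `ψ` would vanish identically, contradicting
injectivity and ψ(1) = 1. -/
lemma gaussSum_ne_zero_of_isPrimitive {m : ℕ} [NeZero m] {ψ : DirichletCharacter ℂ m}
    (hψ : ψ.IsPrimitive) : gaussSum ψ ZMod.stdAddChar ≠ 0 := by
  intro h
  have h0 : ZMod.dft (ψ : ZMod m → ℂ) = 0 := by
    ext j
    rw [hψ.fourierTransform_eq_inv_mul_gaussSum, h, mul_zero, Pi.zero_apply]
  have := congrFun ((LinearEquiv.map_eq_zero_iff _).mp h0) 1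
  simp at this

/-! ### Operations on continued Dirichlet series -/

namespace IsEntireContinuation

variable {a b : ℕ → ℂ} {F : ℂ → ℂ}

lemma congr (h : IsEntireContinuation a F) (hab : ∀ n, n ≠ 0 → a n = b n) :
    IsEntireContinuation b F := by
  obtain ⟨hF, σ, hσ⟩ := h
  exact ⟨hF, σ, fun s hs ↦ (LSeriesHasSum_congr s _ fun {n} hn ↦ hab n hn).mp (hσ s hs)⟩

lemma smul (h : IsEntireContinuation a F) (w : ℂ) :
    IsEntireContinuation (w • a) (fun s ↦ w * F s) := by
  obtain ⟨hF, σ, hσ⟩ := h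
  exact ⟨hF.const_mul w, σ, fun s hs ↦ (hσ s hs).smul w⟩

lemma sum {ι : Type*} (t : Finset ι) {a : ι → ℕ → ℂ} {F : ι → ℂ → ℂ}
    (h : ∀ i ∈ t, IsEntireContinuation (a i) (F i)) :
    IsEntireContinuation (∑ i ∈ t, a i) (fun s ↦ ∑ i ∈ t, F i s) := by
  classical
  induction t using Finset.induction_on with
  | empty =>
    refine ⟨by simp, 0, fun s _ ↦ ?_⟩
    have h0 : LSeries.term 0 s = 0 := by
      ext n
      simp [LSeries.term_def]
    simp only [LSeriesHasSum, Finset.sum_empty, h0]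
    exact hasSum_zero
  | insert i t hi ih =>
    obtain ⟨hF, σ, hσ⟩ := h i (Finset.mem_insert_self i t)
    obtain ⟨hG, τ, hτ⟩ := ih fun j hj ↦ h j (Finset.mem_insert_of_mem hj)
    simp only [Finset.sum_insert hi]
    exact ⟨hF.add hG, max σ τ, fun s hs ↦
      (hσ s ((le_max_left _ _).trans_lt hs)).add (hτ s ((le_max_right _ _).trans_lt hs))⟩

/-- With w = (k-1)/2 this passes from a_f(n) to λ_f(n), moving the central point from k/2 to 1/2. -/
lemma shift (h : IsEntireContinuation a F) (w : ℂ) :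
    IsEntireContinuation (fun n ↦ a n / (n : ℂ) ^ w) (fun s ↦ F (s + w)) := by
  obtain ⟨hF, σ, hσ⟩ := h
  refine ⟨hF.comp (differentiable_id.add_const w), σ - w.re, fun s hs ↦ ?_⟩
  refine (hσ (s + w) (by simp only [Complex.add_re]; linarith)).congr_fun fun n ↦ ?_
  rcases eq_or_ne n 0 with rfl | hn
  · simp
  · rw [LSeries.term_of_ne_zero hn, LSeries.term_of_ne_zero hn,
      Complex.cpow_add _ _ (by exact_mod_cast hn), div_div, mul_comm ((n : ℂ) ^ w)]

lemma dilate (h : IsEntireContinuation a F) {d : ℕ} (hd : d ≠ 0) :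
    IsEntireContinuation (fun n ↦ if d ∣ n then a (n / d) else 0)
      (fun s ↦ (d : ℂ) ^ (-s) * F s) := by
  obtain ⟨hF, σ, hσ⟩ := h
  have hd' : (d : ℂ) ≠ 0 := mod_cast hd
  refine ⟨(differentiable_id.neg.const_cpow (Or.inl hd')).mul hF, σ, fun s hs ↦ ?_⟩
  have h1 := (hasSum_ite_dvd_iff (u := fun n ↦ LSeries.term (fun n ↦ a (n / d)) s n)
    (A := (d : ℂ) ^ (-s) * F s) hd).mpr ?_
  · refine h1.congr_fun fun n ↦ ?_
    rcases eq_or_ne n 0 with rfl | hn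
    · simp
    · simp only [LSeries.term_of_ne_zero hn]
      split_ifs <;> simp
  · refine ((hσ s hs).mul_left ((d : ℂ) ^ (-s))).congr_fun fun l ↦ ?_
    rcases eq_or_ne l 0 with rfl | hl
    · simp
    · rw [LSeries.term_of_ne_zero hl, LSeries.term_of_ne_zero (mul_ne_zero hd hl),
        Nat.mul_div_cancel_left _ (by omega), Nat.cast_mul, Complex.natCast_mul_natCast_cpow,
        Complex.cpow_neg]
      field_simp

end IsEntireContinuation

lemma isEntireContinuation_additiveTwistL_div [NeZero q] (hk : 0 < k) (f : S q k) (a : ℤ)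
    (c : ℕ) : IsEntireContinuation (additiveTwistCoeff f ((a : ℝ) / c))
      (additiveTwistL f ((a : ℝ) / c)) := by
  have := isEntireContinuation_additiveTwistL hk f ((a : ℚ) / c)
  push_cast at this
  exact this

/-- The twist by a primitive character is a linear combination of additive twists. -/
lemma isEntireContinuation_multiplicativeTwistL [NeZero q] (hk : 0 < k) (f : S q k) {m : ℕ}
    [NeZero m] (χ : DirichletCharacter ℂ m) (hχ : χ.IsPrimitive) :
    IsEntireContinuation (multiplicativeTwistCoeff k f χ) (multiplicativeTwistL k f χ) := by
  have hprim : (star χ).IsPrimitive := by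
    rw [MulChar.star_eq_inv, DirichletCharacter.isPrimitive_def, DirichletCharacter.conductor_inv]
    exact hχ
  have hτ := gaussSum_ne_zero_of_isPrimitive hprim
  refine isEntireContinuation_continuedLSeries ⟨_, IsEntireContinuation.congr
    (((IsEntireContinuation.sum (Finset.range m) fun b _ ↦
      ((isEntireContinuation_additiveTwistL_div hk f b m).smul (star χ b))).shift
        (((k : ℂ) - 1) / 2)).smul (gaussSum (star χ) ZMod.stdAddChar)⁻¹) fun n hn ↦ ?_⟩
  -- Here χ(n)τ(χ̄) is the sum of χ̄(b)e(nb/m); dividing by τ(χ̄) recovers χ(n).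
  have h := expSum_self (star χ) hprim n
  rw [MulChar.star_eq_inv, inv_inv, ← MulChar.star_eq_inv, expSum] at h
  have h2 : (∑ b ∈ Finset.range m, star χ b • additiveTwistCoeff f (((b : ℤ) : ℝ) / m)) n =
      fourierCoeff f n * (χ n * gaussSum (star χ) ZMod.stdAddChar) := by
    rw [← h, Finset.sum_apply, Finset.mul_sum]
    refine Finset.sum_congr rfl fun b _ ↦ ?_
    simp only [Pi.smul_apply, smul_eq_mul, additiveTwistCoeff]
    push_cast
    rw [mul_left_comm, mul_div_assoc]
  simp only [Pi.smul_apply, smul_eq_mul, h2, multiplicativeTwistCoeff, heckeEigenvalue]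
  field_simp

/-! ### The formula of Birch and Stevens -/

/-- In `nu` the outer variable is n₁, whereas the Gauss sum expansion produces n₂ first. -/
lemma sum_divisorsAntidiagonal_swap {M : Type*} [AddCommMonoid M] (N : ℕ) (F : ℕ → ℕ → ℕ → M) :
    ∑ x ∈ N.divisorsAntidiagonal, ∑ y ∈ x.2.divisorsAntidiagonal, F x.1 y.1 y.2 =
      ∑ x ∈ N.divisorsAntidiagonal, ∑ y ∈ x.2.divisorsAntidiagonal, F y.1 x.1 y.2 := by
  rw [Finset.sum_sigma', Finset.sum_sigma']
  refine Finset.sum_nbij' (fun x ↦ ⟨(x.2.1, x.1.1 * x.2.2), (x.1.1, x.2.2)⟩)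
    (fun x ↦ ⟨(x.2.1, x.1.1 * x.2.2), (x.1.1, x.2.2)⟩) ?_ ?_ ?_ ?_ ?_
  · rintro ⟨⟨a, b⟩, c, d⟩ h
    simp only [Finset.mem_sigma, Nat.mem_divisorsAntidiagonal] at h ⊢
    obtain ⟨⟨rfl, h1⟩, rfl, h2⟩ := h
    simp only [ne_eq, mul_eq_zero, not_or] at h1 ⊢
    exact ⟨⟨by ring, h1⟩, trivial, h1.1, h1.2.2⟩
  · rintro ⟨⟨a, b⟩, c, d⟩ h
    simp only [Finset.mem_sigma, Nat.mem_divisorsAntidiagonal] at h ⊢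
    obtain ⟨⟨rfl, h1⟩, rfl, h2⟩ := h
    simp only [ne_eq, mul_eq_zero, not_or] at h1 ⊢
    exact ⟨⟨by ring, h1⟩, trivial, h1.1, h1.2.2⟩
  · rintro ⟨⟨a, b⟩, c, d⟩ h
    simp only [Finset.mem_sigma, Nat.mem_divisorsAntidiagonal] at h
    obtain ⟨⟨rfl, h1⟩, rfl, h2⟩ := h
    rfl
  · rintro ⟨⟨a, b⟩, c, d⟩ h
    simp only [Finset.mem_sigma, Nat.mem_divisorsAntidiagonal] at h
    obtain ⟨⟨rfl, h1⟩, rfl, h2⟩ := h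
    rfl
  · rintro ⟨⟨a, b⟩, c, d⟩ h
    rfl

/-- Expansion of `λ_f(n) χ(n/d)`, for `d ∣ n`, into coefficients of `L(f, χ, s)`. -/
lemma IsNewform.heckeEigenvalue_mul_character [NeZero q] {f : S q k} (hf : IsNewform f) {m : ℕ}
    (χ : DirichletCharacter ℂ m) {d n : ℕ} (hd : d ≠ 0) (hn : n ≠ 0) :
    (if d ∣ n then heckeEigenvalue k f n * χ (n / d : ℕ) else 0) =
      ∑ y ∈ d.divisorsAntidiagonal with y.1.Coprime q,
        χ y.1 * (ArithmeticFunction.moebius y.1 : ℂ) * heckeEigenvalue k f y.2 *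
          if d * y.1 ∣ n then multiplicativeTwistCoeff k f χ (n / (d * y.1)) else 0 := by
  split_ifs with h
  · obtain ⟨r, rfl⟩ := h
    have hr : r ≠ 0 := right_ne_zero_of_mul hn
    have hset : (d.gcd r).divisors.filter (·.Coprime q) =
        {e ∈ d.divisors | e.Coprime q ∧ e ∣ r} := by
      ext e
      simp only [Finset.mem_filter, Nat.mem_divisors, Nat.dvd_gcd_iff, ne_eq, Nat.gcd_eq_zero_iff]
      tauto
    rw [Nat.mul_div_cancel_left _ (by omega),
      apply_mul_eq_sum_moebius (fun n m ↦ hf.heckeEigenvalue_mul) hd hr, hset, Finset.sum_mul,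
      Finset.sum_filter, Finset.sum_filter (p := fun y : ℕ × ℕ ↦ y.1.Coprime q),
      Nat.sum_divisorsAntidiagonal (f := fun e e' ↦ if e.Coprime q then
        χ e * (ArithmeticFunction.moebius e : ℂ) * heckeEigenvalue k f e' *
          if d * e ∣ d * r then multiplicativeTwistCoeff k f χ (d * r / (d * e)) else 0 else 0)]
    refine Finset.sum_congr rfl fun e he ↦ ?_
    have he0 : e ≠ 0 := ne_zero_of_dvd_ne_zero hd (Nat.dvd_of_mem_divisors he)
    by_cases h1 : e.Coprime q
    swap
    · rw [if_neg (fun h ↦ h1 h.1), if_neg h1]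
    by_cases h2 : e ∣ r
    swap
    · rw [if_neg (fun h ↦ h2 h.2), if_pos h1, if_neg, mul_zero]
      rwa [Nat.mul_dvd_mul_iff_left (by omega)]
    rw [if_pos ⟨h1, h2⟩, if_pos h1, if_pos (Nat.mul_dvd_mul_left d h2),
      Nat.mul_div_mul_left _ _ (by omega)]
    -- With r = et, the factor χ(r) splits as χ(e)χ(t), and λ_f(t)χ(t) is the twist coefficient at
    -- n/(de) = t.
    obtain ⟨t, rfl⟩ := h2
    rw [Nat.mul_div_cancel_left _ (by omega), multiplicativeTwistCoeff, Nat.cast_mul, map_mul]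
    ring
  · symm
    refine Finset.sum_eq_zero fun y _ ↦ ?_
    rw [if_neg (fun h' ↦ h ((dvd_mul_right _ _).trans h')), mul_zero]

/-- Used with a = n₁ and b = n₃: the Gauss sum contributes n₁n₃ and dilation by n₁²n₃ contributes
its power -1/2. -/
lemma mul_mul_cpow_neg_half {a b : ℕ} (ha : a ≠ 0) (hb : b ≠ 0) :
    ((a * b : ℕ) : ℂ) * ((a * b * a : ℕ) : ℂ) ^ (-(1 / 2) : ℂ) = (b : ℂ) ^ (1 / 2 : ℂ) := by
  have ha' : (a : ℂ) ≠ 0 := mod_cast ha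
  have hb' : (b : ℂ) ≠ 0 := mod_cast hb
  have h1 (x : ℂ) (hx : x ≠ 0) : x ^ (1 / 2 : ℂ) * x ^ (1 / 2 : ℂ) = x := by
    rw [← Complex.cpow_add _ _ hx]
    norm_num
  have h2 := h1 _ ha'
  have h3 := h1 _ hb'
  have ha2 : (a : ℂ) ^ (1 / 2 : ℂ) ≠ 0 := by simp [Complex.cpow_eq_zero_iff, ha']
  have hb2 : (b : ℂ) ^ (1 / 2 : ℂ) ≠ 0 := by simp [Complex.cpow_eq_zero_iff, hb']
  rw [Nat.cast_mul (a * b), Complex.natCast_mul_natCast_cpow, Nat.cast_mul,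
    Complex.natCast_mul_natCast_cpow, Complex.cpow_neg, Complex.cpow_neg]
  field_simp
  rw [sq, sq, h2, h3]

/-- The formula of Birch and Stevens, expressing twists by characters through additive twists. -/
lemma IsNewform.nu_mul_multiplicativeTwistL [NeZero q] (hk : 0 < k) {f : S q k}
    (hf : IsNewform f) {c : ℕ} [NeZero c] (χ : DirichletCharacter ℂ c) :
    nu q k f χ.primitiveCharacter (c / χ.conductor) *
        multiplicativeTwistL k f χ.primitiveCharacter (1 / 2) =
      ∑ a : (ZMod c)ˣ, conj (χ (a : ZMod c)) *
        additiveTwistL f (((a : ZMod c).val : ℝ) / c) ((k : ℂ) / 2) := by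
  set χ' := χ.primitiveCharacter with hχ'
  set N := c / χ.conductor with hN
  set τ := gaussSum (star χ') ZMod.stdAddChar with hτ
  -- `hadd` and `hmul` give two continuations of one Dirichlet series; `hcoeff` matches their
  -- coefficients for `n ≠ 0`.
  have hadd := (IsEntireContinuation.sum Finset.univ fun (u : (ZMod c)ˣ) _ ↦
    (isEntireContinuation_additiveTwistL_div hk f ((u : ZMod c).val : ℤ) c).smul
      (conj (χ (u : ZMod c)))).shift (((k : ℂ) - 1) / 2)
  have hmul := (IsEntireContinuation.sum N.divisorsAntidiagonal fun x hx ↦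
    (IsEntireContinuation.sum (x.2.divisorsAntidiagonal.filter (·.1.Coprime q)) fun y hy ↦
      ((isEntireContinuation_multiplicativeTwistL hk f χ' χ.primitiveCharacter_isPrimitive).dilate
        (d := x.2 * y.1) (mul_ne_zero (Nat.ne_zero_of_mem_divisorsAntidiagonal hx).2
          (Nat.ne_zero_of_mem_divisorsAntidiagonal (Finset.mem_filter.mp hy).1).1)).smul
        (χ' y.1 * (ArithmeticFunction.moebius y.1 : ℂ) * heckeEigenvalue k f y.2)).smul
      ((ArithmeticFunction.moebius x.1 : ℂ) * conj (χ' x.1) * x.2)).smul τ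
  have hcoeff (n : ℕ) (hn : n ≠ 0) : (∑ u : (ZMod c)ˣ, conj (χ (u : ZMod c)) •
      additiveTwistCoeff f ((((u : ZMod c).val : ℤ) : ℝ) / c)) n / (n : ℂ) ^ (((k : ℂ) - 1) / 2) =
      (τ • ∑ x ∈ N.divisorsAntidiagonal,
        ((ArithmeticFunction.moebius x.1 : ℂ) * conj (χ' x.1) * x.2) •
        ∑ y ∈ x.2.divisorsAntidiagonal with y.1.Coprime q,
          (χ' y.1 * (ArithmeticFunction.moebius y.1 : ℂ) * heckeEigenvalue k f y.2) •
          fun n ↦ if x.2 * y.1 ∣ n then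
            multiplicativeTwistCoeff k f χ' (n / (x.2 * y.1)) else 0) n := by
    have h1 : (∑ u : (ZMod c)ˣ, conj (χ (u : ZMod c)) •
        additiveTwistCoeff f ((((u : ZMod c).val : ℤ) : ℝ) / c)) n = fourierCoeff f n *
        ∑ u : (ZMod c)ˣ, conj (χ (u : ZMod c)) *
          Complex.exp (2 * Real.pi * Complex.I * (n * (u : ZMod c).val / c)) := by
      rw [Finset.sum_apply, Finset.mul_sum]
      refine Finset.sum_congr rfl fun u _ ↦ ?_
      simp only [Pi.smul_apply, smul_eq_mul, additiveTwistCoeff]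
      push_cast
      rw [mul_left_comm, mul_div_assoc]
    rw [h1, sum_units_conj_mul_exp, mul_div_right_comm, ← heckeEigenvalue, mul_left_comm,
      Pi.smul_apply, smul_eq_mul, Finset.sum_apply, Finset.mul_sum (a := heckeEigenvalue k f n)]
    congr 1
    refine Finset.sum_congr rfl fun x hx ↦ ?_
    rw [Pi.smul_apply, smul_eq_mul, Finset.sum_apply]
    simp only [Pi.smul_apply, smul_eq_mul]
    rw [← hf.heckeEigenvalue_mul_character χ' (Nat.ne_zero_of_mem_divisorsAntidiagonal hx).2 hn]
    split_ifs
    · ring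
    · ring
  have heq := congrFun ((hadd.congr hcoeff).unique hmul) (1 / 2)
  have hk2 : (1 / 2 : ℂ) + ((k : ℂ) - 1) / 2 = k / 2 := by ring
  simp only [hk2, Int.cast_natCast] at heq
  rw [heq, nu, mul_assoc]
  congr 1
  have hswap := sum_divisorsAntidiagonal_swap N (fun n₁ n₂ n₃ ↦ if n₁.Coprime q then
    χ' n₁ * (ArithmeticFunction.moebius n₁ : ℂ) *
        (conj (χ' n₂) * (ArithmeticFunction.moebius n₂ : ℂ)) *
        (heckeEigenvalue k f n₃ * (n₃ : ℂ) ^ (1 / 2 : ℂ)) else 0)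
  have hleft : ∀ x ∈ N.divisorsAntidiagonal, (if x.1.Coprime q then
      ∑ y ∈ x.2.divisorsAntidiagonal, χ' x.1 * (ArithmeticFunction.moebius x.1 : ℂ) *
        (conj (χ' y.1) * (ArithmeticFunction.moebius y.1 : ℂ)) *
        (heckeEigenvalue k f y.2 * (y.2 : ℂ) ^ (1 / 2 : ℂ)) else 0) =
      ∑ y ∈ x.2.divisorsAntidiagonal, if x.1.Coprime q then
        χ' x.1 * (ArithmeticFunction.moebius x.1 : ℂ) *
        (conj (χ' y.1) * (ArithmeticFunction.moebius y.1 : ℂ)) *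
        (heckeEigenvalue k f y.2 * (y.2 : ℂ) ^ (1 / 2 : ℂ)) else 0 := by
    intro x _
    split_ifs <;> simp
  rw [Finset.sum_filter, Finset.sum_congr rfl hleft, hswap, Finset.sum_mul]
  refine Finset.sum_congr rfl fun x _ ↦ ?_
  rw [Finset.sum_mul, Finset.mul_sum, Finset.sum_filter]
  refine Finset.sum_congr rfl fun y hy ↦ ?_
  split_ifs
  · have hy0 := Nat.ne_zero_of_mem_divisorsAntidiagonal hy
    rw [← mul_mul_cpow_neg_half hy0.1 hy0.2, (Nat.mem_divisorsAntidiagonal.mp hy).1]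
    ring
  · rw [zero_mul]

/-- Orthogonality of characters inverts the formula. -/
lemma sum_characters_mul_sum_units {c : ℕ} [NeZero c] (F : ZMod c → ℂ) {a : ZMod c}
    (ha : IsUnit a) :
    ∑ χ : DirichletCharacter ℂ c, χ a * ∑ u : (ZMod c)ˣ, conj (χ (u : ZMod c)) * F u =
      c.totient * F a := by
  -- Values at units are roots of unity, so conjugation is inversion of the argument.
  have h1 (χ : DirichletCharacter ℂ c) (u : (ZMod c)ˣ) :
      conj (χ (u : ZMod c)) = χ (u : ZMod c)⁻¹ := by
    rw [ZMod.inv_coe_unit, ← Ring.inverse_unit, ← MulChar.inv_apply, ← MulChar.star_apply']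
    rfl
  simp only [h1, Finset.mul_sum]
  rw [Finset.sum_comm]
  have h2 (u : (ZMod c)ˣ) : ∑ χ : DirichletCharacter ℂ c, χ a * (χ (u : ZMod c)⁻¹ * F u) =
      (if (u : ZMod c) = a then (c.totient : ℂ) else 0) * F u := by
    rw [← DirichletCharacter.sum_char_inv_mul_char_eq ℂ u.isUnit, Finset.sum_mul]
    exact Finset.sum_congr rfl fun χ _ ↦ by ring
  simp only [h2]
  obtain ⟨v, rfl⟩ := ha
  simp [Units.val_inj]

/-- As e(nr) has period 1 in r, only the residue of `a` modulo `c` matters. -/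
lemma additiveTwistCoeff_intCast_div (f : ℍ → ℂ) (a : ℤ) (c : ℕ) [NeZero c] :
    additiveTwistCoeff f ((a : ℝ) / c) = additiveTwistCoeff f (((a : ZMod c).val : ℝ) / c) := by
  ext n
  have hc : (c : ℂ) ≠ 0 := mod_cast NeZero.ne c
  have h : (a : ℂ) = ((a : ZMod c).val : ℂ) + c * (a / c : ℤ) := by
    have h1 : ((a : ZMod c).val : ℤ) = a % c := ZMod.val_intCast a
    have h2 : a = ((a : ZMod c).val : ℤ) + c * (a / c) := by rw [h1, Int.emod_add_mul_ediv]
    exact_mod_cast congrArg (Int.cast : ℤ → ℂ) h2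
  rw [additiveTwistCoeff, additiveTwistCoeff]
  congr 1
  rw [Complex.exp_eq_exp_iff_exists_int]
  refine ⟨n * (a / c), ?_⟩
  push_cast
  rw [h]
  field_simp

end BirchStevens

end

open BirchStevens in
theorem proposition5p1 (q c : ℕ) [NeZero q] [NeZero c] (k : ℤ) (hk : 0 < k) (hk_even : Even k)
    (f : S q k) (hf : IsNewform f) :
    -- the `L`-functions whose central values occur have an analytic continuation
    (∀ a : ℤ, IsCoprime a (c : ℤ) →
      IsEntireContinuation (additiveTwistCoeff f ((a : ℝ) / c)) (additiveTwistL f ((a : ℝ) / c))) ∧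
    (∀ χ : DirichletCharacter ℂ c,
      IsEntireContinuation (multiplicativeTwistCoeff k f χ.primitiveCharacter)
        (multiplicativeTwistL k f χ.primitiveCharacter)) ∧
    (∀ χ : DirichletCharacter ℂ c,
      nu q k f χ.primitiveCharacter (c / χ.conductor) *
          multiplicativeTwistL k f χ.primitiveCharacter (1 / 2) =
        ∑ a : (ZMod c)ˣ, conj (χ (a : ZMod c)) *
          additiveTwistL f (((a : ZMod c).val : ℝ) / c) ((k : ℂ) / 2)) ∧
    (∀ a : ℤ, IsCoprime a (c : ℤ) →
      additiveTwistL f ((a : ℝ) / c) ((k : ℂ) / 2) =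
        1 / (c.totient : ℂ) * ∑ χ : DirichletCharacter ℂ c,
          χ (a : ZMod c) * (nu q k f χ.primitiveCharacter (c / χ.conductor) *
            multiplicativeTwistL k f χ.primitiveCharacter (1 / 2))) := by
  have hmain (χ : DirichletCharacter ℂ c) := hf.nu_mul_multiplicativeTwistL hk χ
  refine ⟨fun a _ ↦ isEntireContinuation_additiveTwistL_div hk f a c, fun χ ↦
    isEntireContinuation_multiplicativeTwistL hk f _ χ.primitiveCharacter_isPrimitive, hmain,
    fun a ha ↦ ?_⟩
  have hu : IsUnit (a : ZMod c) := by
    rw [ZMod.coe_int_isUnit_iff_isCoprime]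
    exact ha.symm
  simp only [hmain]
  rw [sum_characters_mul_sum_units (fun x ↦ additiveTwistL f ((x.val : ℝ) / c) ((k : ℂ) / 2)) hu,
    additiveTwistL, additiveTwistCoeff_intCast_div, ← additiveTwistL, ← mul_assoc,
    one_div_mul_cancel (by exact_mod_cast (Nat.totient_pos.mpr (NeZero.pos c)).ne'), one_mul]
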